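/- Let $C_b(\mathbb R)$ be the Banach space of all bounded continuous functions $f:\mathbb R\to\mathbb R$ with the supremum norm. For $f\in C_b(\mathbb R)$ let $h_{\mathrm{top}}(f)$ denote the topological entropy of the restriction of $f$ to the compact invariant set $\overline{f(\mathbb R)}$. A separable real Banach space $V$ is called universal if every separable real Banach space is (linearly) isometrically isomorphic to a closed subspace of $V$. **Theorem.** There is a linear subspace $\mathcal A\subset C_b(\mathbb R)$ which, equipped with the supremum norm, is a universal separable Banach space, such that $h_{\mathrm{top}}(f)=\infty$ for every non-zero $f\in\mathcal A$. -/

import Mathlib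

open scoped BoundedContinuousFunction

universe u

/-- A bounded continuous function `f : ℝ → ℝ` maps the compact set `closure (f(ℝ))` to itself. -/
lemma mapsTo_closure_range (f : ℝ →ᵇ ℝ) :
    Set.MapsTo f (closure (Set.range f)) (closure (Set.range f)) :=
  fun x _ => subset_closure (Set.mem_range_self x)

/-- The topological entropy of `f ∈ C_b(ℝ)`: the topological entropy (Bowen–Dinaburg, with values
in `[-∞, ∞]`) of the restriction of `f` to the compact invariant set `closure (f(ℝ))`. -/
noncomputable def htop (f : ℝ →ᵇ ℝ) : EReal :=
  Dynamics.coverEntropy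
    (Set.MapsTo.restrict f (closure (Set.range f)) (closure (Set.range f)) (mapsTo_closure_range f))
    Set.univ

/-- A universal separable Banach space: a separable Banach space `V` such that every real separable
Banach space `E` is (linearly) isometrically isomorphic to a closed subspace of `V`. -/
def IsUniversalSeparableBanach (V : Type*) [NormedAddCommGroup V] [NormedSpace ℝ V] : Prop :=
  CompleteSpace V ∧ TopologicalSpace.SeparableSpace V ∧
    ∀ (E : Type u) [NormedAddCommGroup E] [NormedSpace ℝ E] [CompleteSpace E]
      [TopologicalSpace.SeparableSpace E],
      ∃ M : Submodule ℝ V, IsClosed (M : Set V) ∧ Nonempty (E ≃ₗᵢ[ℝ] M)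

/-! A sequence `c` in `ℓ^∞` is encoded linearly as `wave c`. Peaks of height `|c k|` on the negative
half-line make the encoding isometric. On `I_n = [1/(n+1), 1/n]` the function oscillates `n` times
with amplitude about `|c k|/√n`, which exceeds the bound `1/n` on `I_n` once `n` is large and `c k ≠
0`. Every oscillation then covers `I_n`, a horseshoe with `n` legs, so the entropy is at least `log
n`. Each `k` serves infinitely many `n`, hence the entropy is infinite. Separability comes from
restricting the encoding to a copy of `C(2^ℕ, ℝ)` in `ℓ^∞`, which is universal by Banach–Mazur. -/

/-! ### Entropy from horseshoes -/

/-- If each `J i ⊆ I` is mapped onto a superset of `I`, every itinerary through the `J i` is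
realized by a point of `I`. -/
lemma exists_mem_iterate_mem_of_subset_image {X ι : Type*} {T : X → X} {I : Set X}
    (hI : I.Nonempty) {J : ι → Set X} (hJI : ∀ i, J i ⊆ I) (hIJ : ∀ i, I ⊆ T '' J i) :
    ∀ (n : ℕ) (w : Fin n → ι), ∃ x ∈ I, ∀ k : Fin n, T^[k] x ∈ J (w k) := by
  intro n
  induction n with
  | zero => exact fun _ => ⟨hI.some, hI.some_mem, fun k => k.elim0⟩
  | succ n ih =>
    intro w
    obtain ⟨y, hyI, hy⟩ := ih (Fin.tail w)
    obtain ⟨x, hx, rfl⟩ := hIJ (w 0) hyI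
    exact ⟨x, hJI _ hx, Fin.cases hx hy⟩

/-- A horseshoe with `card ι` uniformly separated legs forces entropy at least `log (card ι)`. -/
lemma log_card_le_coverEntropy {X ι : Type*} [PseudoMetricSpace X] [Fintype ι] {T : X → X}
    {I : Set X} (hI : I.Nonempty) {J : ι → Set X} (hJI : ∀ i, J i ⊆ I)
    (hIJ : ∀ i, I ⊆ T '' J i) {δ : ℝ} (hδ : 0 < δ)
    (hsep : ∀ i j, i ≠ j → ∀ x ∈ J i, ∀ y ∈ J j, δ ≤ dist x y) :
    ENNReal.log (Fintype.card ι) ≤ Dynamics.coverEntropy T Set.univ := by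
  classical
  refine le_trans ?_ (Dynamics.netEntropyEntourage_le_coverEntropy T Set.univ
    (Metric.dist_mem_uniformity (half_pos hδ)))
  -- `log (card ι)` is the growth rate of `(card ι) ^ n`, the number of itineraries of length `n`.
  rw [Dynamics.netEntropyEntourage, ← ExpGrowth.expGrowthSup_pow]
  refine ExpGrowth.expGrowthSup_monotone fun n => ?_
  choose p _ hp using exists_mem_iterate_mem_of_subset_image hI hJI hIJ n
  -- Distinct itineraries differ at some time, when their points are `δ` apart, so their dynamical
  -- balls of radius `δ / 2` are disjoint.
  have key (v w : Fin n → ι) (z : X)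
      (hv : z ∈ UniformSpace.ball (p v)
        (Dynamics.dynEntourage T {q : X × X | dist q.1 q.2 < δ / 2} n))
      (hw : z ∈ UniformSpace.ball (p w)
        (Dynamics.dynEntourage T {q : X × X | dist q.1 q.2 < δ / 2} n)) : v = w := by
    funext k
    by_contra hne
    have h1 : dist (T^[k] (p v)) (T^[k] z) < δ / 2 := Dynamics.mem_dynEntourage.1 hv k k.2
    have h2 : dist (T^[k] (p w)) (T^[k] z) < δ / 2 := Dynamics.mem_dynEntourage.1 hw k k.2
    have h3 := hsep _ _ hne _ (hp v k) _ (hp w k)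
    have h4 := dist_triangle_right (T^[k] (p v)) (T^[k] (p w)) (T^[k] z)
    linarith
  have self (v : Fin n → ι) : p v ∈ UniformSpace.ball (p v)
      (Dynamics.dynEntourage T {q : X × X | dist q.1 q.2 < δ / 2} n) :=
    Dynamics.mem_dynEntourage.2 fun k _ => by simpa using hδ
  have hinj : Function.Injective p := fun v w h => key v w (p v) (self v) (h ▸ self w)
  have hnet : Dynamics.IsDynNetIn T Set.univ {q : X × X | dist q.1 q.2 < δ / 2} n
      ((Finset.univ.image p : Finset X) : Set X) := by
    refine ⟨Set.subset_univ _, ?_⟩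
    simp only [Finset.coe_image, Finset.coe_univ, Set.image_univ]
    rintro _ ⟨v, rfl⟩ _ ⟨w, rfl⟩ hne
    exact Set.disjoint_left.2 fun z hz hz' => hne (congrArg p (key v w z hz hz'))
  have hcard := hnet.card_le_netMaxcard
  rw [Finset.card_image_of_injective _ hinj] at hcard
  simpa using ENat.toENNReal_mono hcard

/-- A bounded continuous function with horseshoes of arbitrarily many legs has infinite entropy. -/
lemma htop_eq_top_of_horseshoes (f : ℝ →ᵇ ℝ)
    (h : ∀ N : ℕ, ∃ n ≥ N, ∃ (I : Set ℝ) (J : Fin n → Set ℝ) (δ : ℝ), I.Nonempty ∧ 0 < δ ∧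
      (∀ i, J i ⊆ I) ∧ (∀ i, I ⊆ f '' J i) ∧
      ∀ i j, i ≠ j → ∀ x ∈ J i, ∀ y ∈ J j, δ ≤ dist x y) : htop f = ⊤ := by
  have bound (N : ℕ) : ENNReal.log N ≤ htop f := by
    obtain ⟨n, hn, I, J, δ, hI, hδ, hJI, hIJ, hsep⟩ := h N
    rcases Nat.eq_zero_or_pos N with rfl | hN
    · simp
    have hIr : I ⊆ closure (Set.range f) := fun x hx => by
      obtain ⟨y, -, rfl⟩ := hIJ ⟨0, by omega⟩ hx
      exact subset_closure (Set.mem_range_self y)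
    have := log_card_le_coverEntropy (ι := Fin n)
      (T := Set.MapsTo.restrict f (closure (Set.range f)) (closure (Set.range f))
        (mapsTo_closure_range f)) (I := Subtype.val ⁻¹' I) (J := fun i => Subtype.val ⁻¹' J i)
      ⟨⟨hI.some, hIr hI.some_mem⟩, hI.some_mem⟩ (fun i x hx => hJI i hx) (fun i x hx => by
        obtain ⟨y, hy, hyx⟩ := hIJ i hx
        exact ⟨⟨y, hIr (hJI i hy)⟩, hy, Subtype.ext hyx⟩) hδ
      (fun i j hij x hx y hy => hsep i j hij x hx y hy)
    refine le_trans (ENNReal.log_monotone ?_) this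
    simpa using hn
  by_contra hne
  have hlt : EReal.exp (htop f) < ⊤ := by
    rw [← ENNReal.log_lt_log_iff]
    simpa using lt_top_iff_ne_top.2 hne
  obtain ⟨N, hN⟩ := ENNReal.exists_nat_gt hlt.ne
  have := ENNReal.log_lt_log hN
  rw [EReal.log_exp] at this
  exact absurd (bound N) (not_le.2 this)

/-! ### Universality of `C(2^ℕ, ℝ)` -/

/-- Evaluation along a dense sequence embeds `C(X, ℝ)` isometrically into `ℓ^∞`. -/
noncomputable def evalSeq {X : Type*} [TopologicalSpace X] [CompactSpace X] (q : ℕ → X)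
    (hq : DenseRange q) : C(X, ℝ) →ₗᵢ[ℝ] (ℕ →ᵇ ℝ) where
  toFun g := BoundedContinuousFunction.ofNormedAddCommGroup (fun k => g (q k))
    continuous_of_discreteTopology ‖g‖ fun k => g.norm_coe_le_norm _
  map_add' _ _ := rfl
  map_smul' _ _ := rfl
  norm_map' g := by
    refine le_antisymm (BoundedContinuousFunction.norm_ofNormedAddCommGroup_le _
      (norm_nonneg _) fun k => g.norm_coe_le_norm _) ?_
    refine (ContinuousMap.norm_le _ (norm_nonneg _)).2 fun x => ?_
    refine hq.induction_on (p := fun x => ‖g x‖ ≤ _) x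
      (isClosed_le (by fun_prop) continuous_const) fun k => ?_
    exact BoundedContinuousFunction.norm_coe_le_norm
      (BoundedContinuousFunction.ofNormedAddCommGroup (fun k => g (q k))
        continuous_of_discreteTopology ‖g‖ fun k => g.norm_coe_le_norm _) k

/-- **Banach–Mazur theorem** for the Cantor space: `C(2^ℕ, ℝ)` contains every separable real
normed space isometrically. -/
theorem exists_linearIsometry_cantor (E : Type*) [NormedAddCommGroup E] [NormedSpace ℝ E]
    [TopologicalSpace.SeparableSpace E] : Nonempty (E →ₗᵢ[ℝ] C(ℕ → Bool, ℝ)) := by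
  let K : Set (WeakDual ℝ E) := WeakDual.toStrongDual ⁻¹' Metric.closedBall 0 1
  have hK : IsCompact K := WeakDual.isCompact_closedBall 0 1
  have : CompactSpace K := isCompact_iff_compactSpace.1 hK
  have := WeakDual.metrizable_of_isCompact ℝ E K hK
  let : MetricSpace K := TopologicalSpace.metrizableSpaceMetric K
  have : Nonempty K := ⟨⟨0, by simp [K]⟩⟩
  obtain ⟨φ, hφ, hsurj⟩ := exists_nat_bool_continuous_surjective_of_compact K
  have norm_le (x : E) (w : K) : ‖(w : WeakDual ℝ E) x‖ ≤ ‖x‖ := by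
    have hw : ‖WeakDual.toStrongDual (w : WeakDual ℝ E)‖ ≤ 1 :=
      mem_closedBall_zero_iff.1 w.2
    exact (WeakDual.toStrongDual (w : WeakDual ℝ E)).le_of_opNorm_le hw x |>.trans_eq (one_mul _)
  refine ⟨{
    toFun x := ⟨fun s => (φ s : WeakDual ℝ E) x,
      (WeakDual.eval_continuous x).comp (continuous_subtype_val.comp hφ)⟩
    map_add' x y := ContinuousMap.ext fun s => map_add (φ s : WeakDual ℝ E) x y
    map_smul' c x := ContinuousMap.ext fun s => map_smul (φ s : WeakDual ℝ E) c x
    norm_map' x := le_antisymm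
      ((ContinuousMap.norm_le _ (norm_nonneg _)).2 fun s => norm_le x (φ s)) ?_ }⟩
  -- A Hahn–Banach norming functional lies in the dual ball, hence in the image of the Cantor space.
  obtain ⟨g, hg, hgx⟩ := exists_dual_vector'' ℝ x
  obtain ⟨s, hs⟩ := hsurj ⟨StrongDual.toWeakDual g, by simpa [K] using hg⟩
  refine le_trans ?_ (ContinuousMap.norm_coe_le_norm _ s)
  change ‖x‖ ≤ ‖(φ s : WeakDual ℝ E) x‖
  rw [hs]
  change ‖x‖ ≤ ‖g x‖
  rw [hgx]
  simp

/-- The range of a linear isometry from `C(2^ℕ, ℝ)` is a universal separable Banach space. -/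
theorem isUniversalSeparableBanach_range {V : Type*} [NormedAddCommGroup V] [NormedSpace ℝ V]
    (S : C(ℕ → Bool, ℝ) →ₗᵢ[ℝ] V) :
    IsUniversalSeparableBanach.{u} (LinearMap.range S.toLinearMap) := by
  refine ⟨?_, ?_, fun E _ _ _ _ => ?_⟩
  · exact completeSpace_coe_iff_isComplete.2 S.isometry.isUniformInducing.isComplete_range
  · exact (TopologicalSpace.isSeparable_range S.continuous).separableSpace
  · obtain ⟨ψ⟩ := exists_linearIsometry_cantor E
    let χ : E →ₗᵢ[ℝ] LinearMap.range S.toLinearMap := S.equivRange.toLinearIsometry.comp ψ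
    exact ⟨LinearMap.range χ.toLinearMap,
      χ.isometry.isUniformInducing.isComplete_range.isClosed, ⟨χ.equivRange⟩⟩

/-! ### The encoding of sequences as functions -/

/-- The function which on `[n, n + 1)` is the sine wave `u ↦ c n * sin (m n * π * u)`. -/
noncomputable def floorWave (c : ℤ → ℝ) (m : ℤ → ℤ) (u : ℝ) : ℝ :=
  c ⌊u⌋ * Real.sin (m ⌊u⌋ * u * Real.pi)

lemma continuous_floorWave (c : ℤ → ℝ) (m : ℤ → ℤ) : Continuous (floorWave c m) := by
  have hlf : LocallyFinite fun n : ℤ => Set.Icc (n : ℝ) (n + 1) :=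
    locallyFinite_Icc_of_tendsto tendsto_intCast_atTop_atTop
      (Filter.tendsto_atBot_add_const_right _ _
        (Int.cast_mono.tendsto_atBot_atBot fun b => ⟨⌊b⌋, Int.floor_le b⟩))
  refine hlf.continuous (Set.iUnion_eq_univ_iff.2 fun u => ⟨⌊u⌋, Int.floor_le u,
    (Int.lt_floor_add_one u).le⟩) (fun _ => isClosed_Icc) fun n => ?_
  refine ContinuousOn.congr (f := fun u => c n * Real.sin (m n * u * Real.pi))
    (by fun_prop) fun u hu => ?_
  rcases hu.2.eq_or_lt with rfl | hlt
  · have vanish (j k : ℤ) : Real.sin (j * (k + 1) * Real.pi) = 0 := by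
      exact_mod_cast Real.sin_int_mul_pi (j * (k + 1))
    simp [floorWave, vanish]
  · simp [floorWave, Int.floor_eq_iff.2 ⟨hu.1, hlt⟩]

lemma abs_floorWave_le {c : ℤ → ℝ} {C : ℝ} (hc : ∀ n, |c n| ≤ C) (m : ℤ → ℤ) (u : ℝ) :
    |floorWave c m u| ≤ C := by
  rw [floorWave, abs_mul]
  exact (mul_le_of_le_one_right (abs_nonneg _) (Real.abs_sin_le_one _)).trans (hc _)

/-- The terms of the sequence `c`, each listed once along the negative integers. -/
def negCoeff (c : ℕ → ℝ) (n : ℤ) : ℝ := if n < 0 then c (-n - 1).toNat else 0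

/-- The terms of the sequence `c`, each listed infinitely often along the positive integers. -/
def posCoeff (c : ℕ → ℝ) (n : ℤ) : ℝ := if 0 < n then c n.toNat.unpair.1 else 0

/-- On `(-∞, 0]` this function is a sine wave with one of the terms of `c` as amplitude on each
interval between integers; on `[1 / (n + 1), 1 / n]` it makes `n` oscillations of amplitude
`√x * |c k|`, where each index `k` is used for infinitely many `n`. -/
noncomputable def wave (c : ℕ → ℝ) (x : ℝ) : ℝ :=
  floorWave (negCoeff c) 1 x + √x * floorWave (posCoeff c) (fun n => 2 * n) x⁻¹

lemma abs_negCoeff_le {c : ℕ → ℝ} {C : ℝ} (hc : ∀ k, |c k| ≤ C) (n : ℤ) : |negCoeff c n| ≤ C := by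
  have : 0 ≤ C := (abs_nonneg _).trans (hc 0)
  unfold negCoeff
  split_ifs <;> simp [hc, this]

lemma abs_posCoeff_le {c : ℕ → ℝ} {C : ℝ} (hc : ∀ k, |c k| ≤ C) (n : ℤ) : |posCoeff c n| ≤ C := by
  have : 0 ≤ C := (abs_nonneg _).trans (hc 0)
  unfold posCoeff
  split_ifs <;> simp [hc, this]

lemma wave_of_nonpos (c : ℕ → ℝ) {x : ℝ} (hx : x ≤ 0) :
    wave c x = floorWave (negCoeff c) 1 x := by
  simp [wave, Real.sqrt_eq_zero_of_nonpos hx]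

lemma wave_of_nonneg (c : ℕ → ℝ) {x : ℝ} (hx : 0 ≤ x) :
    wave c x = √x * floorWave (posCoeff c) (fun n => 2 * n) x⁻¹ := by
  have : ¬ ⌊x⌋ < 0 := not_lt.2 (Int.floor_nonneg.2 hx)
  simp [wave, floorWave, negCoeff, this]

lemma continuous_wave {c : ℕ → ℝ} {C : ℝ} (hc : ∀ k, |c k| ≤ C) : Continuous (wave c) := by
  refine (continuous_floorWave _ _).add (continuous_iff_continuousAt.2 fun x => ?_)
  rcases eq_or_ne x 0 with rfl | hx
  · rw [ContinuousAt, Real.sqrt_zero, zero_mul]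
    refine squeeze_zero_norm (a := fun x => √x * C) (fun x => ?_) ?_
    · rw [norm_mul, Real.norm_eq_abs, Real.norm_eq_abs, abs_of_nonneg (Real.sqrt_nonneg x)]
      exact mul_le_mul_of_nonneg_left (abs_floorWave_le (abs_posCoeff_le hc) _ _)
        (Real.sqrt_nonneg x)
    · have : Continuous fun x : ℝ => √x * C := by fun_prop
      simpa using this.tendsto 0
  · exact Real.continuous_sqrt.continuousAt.mul
      ((continuous_floorWave _ _).continuousAt.comp (continuousAt_inv₀ hx))

lemma abs_wave_le {c : ℕ → ℝ} {C : ℝ} (hc : ∀ k, |c k| ≤ C) (x : ℝ) : |wave c x| ≤ C := by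
  rcases le_total x 0 with hx | hx
  · rw [wave_of_nonpos c hx]
    exact abs_floorWave_le (abs_negCoeff_le hc) _ _
  rw [wave_of_nonneg c hx]
  rcases le_or_gt x 1 with h1 | h1
  · rw [abs_mul, abs_of_nonneg (Real.sqrt_nonneg x)]
    exact (mul_le_of_le_one_left (abs_nonneg _) (Real.sqrt_le_one.2 h1)).trans
      (abs_floorWave_le (abs_posCoeff_le hc) _ _)
  -- The factor `√x` exceeds `1` here, but `posCoeff` vanishes at `0`.
  · have : ⌊x⁻¹⌋ = 0 := Int.floor_eq_zero_iff.2 ⟨by positivity, inv_lt_one_of_one_lt₀ h1⟩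
    simpa [floorWave, this] using (abs_nonneg _).trans (hc 0)

lemma abs_wave_neg_half (c : ℕ → ℝ) (k : ℕ) : |wave c (-k - 1 / 2)| = |c k| := by
  have hk : (0 : ℝ) ≤ k := k.cast_nonneg
  have hfl : ⌊(-k - 1 / 2 : ℝ)⌋ = -k - 1 := by
    rw [Int.floor_eq_iff]
    push_cast
    constructor <;> linarith
  have hsin : |Real.sin ((-k - 1 / 2) * Real.pi)| = 1 := by
    rw [show (-k - 1 / 2) * Real.pi = -(Real.pi / 2 + k * Real.pi) by ring, Real.sin_neg,
      abs_neg, Real.sin_add_nat_mul_pi]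
    simp
  rw [wave_of_nonpos c (by linarith), floorWave, hfl, abs_mul]
  have hneg : (-(k : ℤ) - 1) < 0 := by omega
  have hto : (-(-(k : ℤ) - 1) - 1).toNat = k := by omega
  simp only [negCoeff, if_pos hneg, hto, Pi.one_apply, Int.cast_one, one_mul, hsin, mul_one]

/-- The isometric embedding `c ↦ wave c` of `ℓ^∞` into `C_b(ℝ)`. -/
noncomputable def waveIsometry : (ℕ →ᵇ ℝ) →ₗᵢ[ℝ] (ℝ →ᵇ ℝ) where
  toFun c := BoundedContinuousFunction.ofNormedAddCommGroup (wave c)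
    (continuous_wave c.norm_coe_le_norm) ‖c‖ (abs_wave_le c.norm_coe_le_norm)
  map_add' c d := by
    ext x
    have h1 n : negCoeff (c + d) n = negCoeff c n + negCoeff d n := by
      unfold negCoeff; split_ifs <;> simp
    have h2 n : posCoeff (c + d) n = posCoeff c n + posCoeff d n := by
      unfold posCoeff; split_ifs <;> simp
    simp only [BoundedContinuousFunction.coe_ofNormedAddCommGroup,
      BoundedContinuousFunction.coe_add, Pi.add_apply, wave, floorWave] at h1 h2 ⊢
    rw [h1, h2]
    ring
  map_smul' t c := by
    ext x
    have h1 n : negCoeff (fun k => t * c k) n = t * negCoeff c n := by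
      unfold negCoeff; split_ifs <;> simp
    have h2 n : posCoeff (fun k => t * c k) n = t * posCoeff c n := by
      unfold posCoeff; split_ifs <;> simp
    simp only [BoundedContinuousFunction.coe_ofNormedAddCommGroup, RingHom.id_apply,
      BoundedContinuousFunction.coe_smul, wave, floorWave, smul_eq_mul] at h1 h2 ⊢
    rw [h1, h2]
    ring
  norm_map' c := by
    refine le_antisymm (BoundedContinuousFunction.norm_ofNormedAddCommGroup_le _
      (norm_nonneg _) (abs_wave_le c.norm_coe_le_norm)) ?_
    refine (BoundedContinuousFunction.norm_le (norm_nonneg _)).2 fun k => ?_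
    rw [Real.norm_eq_abs, ← abs_wave_neg_half c k]
    exact BoundedContinuousFunction.norm_coe_le_norm
      (BoundedContinuousFunction.ofNormedAddCommGroup (wave c)
        (continuous_wave c.norm_coe_le_norm) ‖c‖ (abs_wave_le c.norm_coe_le_norm)) (-k - 1 / 2)

/-! ### Horseshoes of the encoded functions -/

lemma wave_inv (c : ℕ → ℝ) {n : ℕ} (hn : 0 < n) {u : ℝ} (hu : (n : ℝ) ≤ u) (hu' : u < n + 1) :
    wave c u⁻¹ = √u⁻¹ * (c n.unpair.1 * Real.sin (2 * n * u * Real.pi)) := by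
  have h0 : (0 : ℝ) < n := by exact_mod_cast hn
  have hfl : ⌊u⌋ = n := Int.floor_eq_iff.2 ⟨by simpa using hu, by simpa using hu'⟩
  have hn' : (0 : ℤ) < n := by exact_mod_cast hn
  rw [wave_of_nonneg c (by have := h0.trans_le hu; positivity), floorWave, inv_inv, hfl, posCoeff,
    if_pos hn']
  simp

/-- The `i`-th leg of the horseshoe of `wave c` in `[1 / (n + 1), 1 / n]`. -/
def waveLeg (n i : ℕ) : Set ℝ :=
  Set.Icc (n + (4 * i + 3) / (4 * n) : ℝ)⁻¹ (n + (4 * i + 1) / (4 * n) : ℝ)⁻¹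

lemma waveLeg_subset {n i : ℕ} (hi : i < n) : waveLeg n i ⊆ Set.Icc (n + 1 : ℝ)⁻¹ (n : ℝ)⁻¹ := by
  have hn : (0 : ℝ) < n := by exact_mod_cast (Nat.zero_le i).trans_lt hi
  have hi' : (i : ℝ) + 1 ≤ n := by exact_mod_cast hi
  refine Set.Icc_subset_Icc (inv_anti₀ (by positivity) ?_) (inv_anti₀ hn ?_)
  · gcongr
    rw [div_le_one (by positivity)]
    linarith
  · have : (0 : ℝ) ≤ (4 * i + 1) / (4 * n) := by positivity
    linarith

/-- In the coordinate `u = 1 / x` the legs are at least `1 / (2 * n)` apart, and inversion on `[n, n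
+ 1]` shrinks distances by at most `(n + 1) ^ 2`. -/
lemma dist_waveLeg {n i j : ℕ} (hi : i < n) (hj : j < n) (hij : i < j) {x y : ℝ}
    (hx : x ∈ waveLeg n i) (hy : y ∈ waveLeg n j) :
    1 / (2 * n * (n + 1) ^ 2 : ℝ) ≤ x - y := by
  have hn : (0 : ℝ) < n := by exact_mod_cast (Nat.zero_le i).trans_lt hi
  have hj' : (j : ℝ) + 1 ≤ n := by exact_mod_cast hj
  have hij' : (i : ℝ) + 1 ≤ j := by exact_mod_cast hij
  set a : ℝ := n + (4 * i + 3) / (4 * n) with ha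
  set b : ℝ := n + (4 * j + 1) / (4 * n) with hb
  have ha0 : 0 < a := by positivity
  have hb0 : 0 < b := by positivity
  have hb1 : b ≤ n + 1 := by
    rw [hb]
    gcongr
    rw [div_le_one (by positivity)]
    linarith
  have hab : 1 / (2 * n) ≤ b - a := by
    rw [ha, hb, add_sub_add_left_eq_sub, ← sub_div, div_le_div_iff₀ (by positivity) (by positivity)]
    nlinarith
  have ha1 : a ≤ n + 1 := by
    have : 0 < 1 / (2 * n : ℝ) := by positivity
    linarith
  have hab0 : 0 ≤ b - a := le_trans (by positivity) hab
  calc 1 / (2 * n * (n + 1) ^ 2 : ℝ) = 1 / (2 * n) / ((n + 1) * (n + 1)) := by field_simp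
    _ ≤ (b - a) / (a * b) := by gcongr
    _ = a⁻¹ - b⁻¹ := by field_simp
    _ ≤ x - y := sub_le_sub hx.1 hy.2

/-- The ends of a leg are a consecutive crest and trough (`r = 1, 3`, in quarter periods) of the
sine in `u = 1 / x`. The values there have opposite signs and size at least `1 / n`, so the
intermediate value theorem applies. -/
lemma subset_wave_image_waveLeg {c : ℕ → ℝ} (hcont : Continuous (wave c)) {n i : ℕ} (hi : i < n)
    (hc : 2 ≤ n * c n.unpair.1 ^ 2) :
    Set.Icc (n + 1 : ℝ)⁻¹ (n : ℝ)⁻¹ ⊆ wave c '' waveLeg n i := by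
  have hn : (0 : ℝ) < n := by exact_mod_cast (Nat.zero_le i).trans_lt hi
  have hn1 : (1 : ℝ) ≤ n := by exact_mod_cast (Nat.zero_le i).trans_lt hi
  have hi' : (i : ℝ) + 1 ≤ n := by exact_mod_cast hi
  have value (r : ℝ) (hr : 0 ≤ r) (hr' : r < 4) : wave c (n + (4 * i + r) / (4 * n))⁻¹ =
      √(n + (4 * i + r) / (4 * n))⁻¹ * (c n.unpair.1 * Real.sin (r * (Real.pi / 2))) := by
    rw [wave_inv c ((Nat.zero_le i).trans_lt hi)
      (le_add_of_nonneg_right (by positivity)) (by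
        gcongr
        rw [div_lt_one (by positivity)]
        linarith)]
    congr 2
    rw [show 2 * n * (n + (4 * i + r) / (4 * n)) * Real.pi =
      r * (Real.pi / 2) + ((n ^ 2 + i : ℕ) : ℝ) * (2 * Real.pi) by push_cast; field_simp; ring,
      Real.sin_add_nat_mul_two_pi]
  have large (r : ℝ) (hr : 0 ≤ r) (hr' : r < 4) :
      (n : ℝ)⁻¹ ≤ √(n + (4 * i + r) / (4 * n))⁻¹ * |c n.unpair.1| := by
    have hle : n + (4 * i + r) / (4 * n) ≤ (n + 1 : ℝ) := by
      gcongr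
      rw [div_le_one (by positivity)]
      linarith
    refine abs_le_of_sq_le_sq' ?_ (by positivity) |>.2
    rw [mul_pow, Real.sq_sqrt (by positivity), sq_abs]
    -- The constant `2` in `hc` absorbs the passage from `n + 1` to `n`, as `n + 1 ≤ 2 * n`.
    calc ((n : ℝ)⁻¹) ^ 2 ≤ (n + 1 : ℝ)⁻¹ * (2 / n) := by
          rw [inv_pow, ← one_div, ← one_div, div_mul_div_comm,
            div_le_div_iff₀ (by positivity) (by positivity)]
          nlinarith
      _ ≤ _ := by
          gcongr
          rw [div_le_iff₀ hn]
          linarith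
  have h1 := value 1 (by norm_num) (by norm_num)
  have h3 := value 3 (by norm_num) (by norm_num)
  have l1 := large 1 (by norm_num) (by norm_num)
  have l3 := large 3 (by norm_num) (by norm_num)
  have sin3 : Real.sin (3 * (Real.pi / 2)) = -1 := by
    rw [show 3 * (Real.pi / 2) = Real.pi / 2 + Real.pi by ring, Real.sin_add_pi,
      Real.sin_pi_div_two]
  rw [one_mul, Real.sin_pi_div_two, mul_one] at h1
  rw [sin3] at h3
  have hpq : (n + (4 * i + 3) / (4 * n) : ℝ)⁻¹ ≤ (n + (4 * i + 1) / (4 * n) : ℝ)⁻¹ := by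
    apply inv_anti₀ (by positivity)
    gcongr
    norm_num
  have ninv : (0 : ℝ) < (n : ℝ)⁻¹ := by positivity
  refine Set.Subset.trans (fun y hy => ?_)
    ((intermediate_value_uIcc hcont.continuousOn).trans
      (Set.image_mono (Set.uIcc_of_le hpq).subset))
  have hy0 : 0 ≤ y := le_trans (by positivity) hy.1
  have hy1 := hy.2
  rw [h1, h3, Set.mem_uIcc]
  rcases abs_cases (c n.unpair.1) with ⟨h, -⟩ | ⟨h, -⟩ <;> rw [h] at l1 l3
  · left
    constructor <;> linarith
  · right
    constructor <;> linarith

lemma htop_waveIsometry {c : ℕ →ᵇ ℝ} (hc : c ≠ 0) : htop (waveIsometry c) = ⊤ := by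
  obtain ⟨k, hk⟩ : ∃ k, c k ≠ 0 := by
    by_contra! h
    exact hc (BoundedContinuousFunction.ext h)
  have hk2 : 0 < c k ^ 2 := by positivity
  refine htop_eq_top_of_horseshoes _ fun N => ?_
  obtain ⟨M, hM⟩ := exists_nat_ge (2 / c k ^ 2)
  -- Pairing `k` with a large number gives a large `n` whose amplitude index is `k`.
  have hle : max (max N M) 1 ≤ Nat.pair k (max (max N M) 1) := Nat.right_le_pair _ _
  set n := Nat.pair k (max (max N M) 1) with hn
  have hun : n.unpair.1 = k := by simp [hn]
  have hn0 : (0 : ℝ) < n := by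
    have : 0 < n := by omega
    exact_mod_cast this
  have hMn : (M : ℝ) ≤ n := by
    have : M ≤ n := by omega
    exact_mod_cast this
  have hamp : 2 ≤ n * c n.unpair.1 ^ 2 := by
    rw [hun, ← div_le_iff₀ hk2]
    exact hM.trans hMn
  refine ⟨n, by omega, Set.Icc (n + 1 : ℝ)⁻¹ (n : ℝ)⁻¹, fun i => waveLeg n i,
    1 / (2 * n * (n + 1) ^ 2 : ℝ), Set.nonempty_Icc.2 (inv_anti₀ hn0 (by linarith)), by positivity,
    fun i => waveLeg_subset i.2, fun i => subset_wave_image_waveLeg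
      (continuous_wave c.norm_coe_le_norm) i.2 hamp, fun i j hij x hx y hy => ?_⟩
  rcases lt_or_gt_of_ne (Fin.val_ne_of_ne hij) with h | h
  · exact (dist_waveLeg i.2 j.2 h hx hy).trans (le_abs_self _)
  · rw [dist_comm]
    exact (dist_waveLeg j.2 i.2 h hy hx).trans (le_abs_self _)

theorem theorem3p5 :
    ∃ A : Submodule ℝ (ℝ →ᵇ ℝ),
      IsUniversalSeparableBanach.{u} A ∧ ∀ f ∈ A, f ≠ 0 → htop f = ⊤ := by
  let S := waveIsometry.comp
    (evalSeq _ (TopologicalSpace.denseRange_denseSeq (ℕ → Bool)))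
  refine ⟨LinearMap.range S.toLinearMap, isUniversalSeparableBanach_range S, ?_⟩
  rintro _ ⟨g, rfl⟩ hne
  refine htop_waveIsometry fun h => hne ?_
  change waveIsometry _ = 0
  rw [h, map_zero]
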